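/- All maps are continuous; a compactum is a compact Hausdorff space (possibly empty), and $\mathbf{Comp}$ is the category of compacta and continuous maps. A map is skeletal if preimages of nowhere dense sets are nowhere dense. The weight $w(X)$ is the least cardinality of a base of $X$. An $\omega$-spectrum is an inverse spectrum $\{X_\alpha,p_\alpha^\beta,\Sigma\}$ over a partially ordered set $\Sigma$ such that each $X_\alpha$ has countable weight, each countable subset of $\Sigma$ has a least upper bound in $\Sigma$, and for every non-empty countable directed $\Sigma'\subset\Sigma$ with $\gamma=\sup\Sigma'$ the canonical map $X_\gamma\to\lim\{X_\alpha,p_\alpha^\beta,\Sigma'\}$ is a homeomorphism. A compactum is skeletally generated if it is homeomorphic to the limit of an $\omega$-spectrum of metrizable compacta with surjective skeletal bonding maps $p_\alpha^\beta:X_\beta\to X_\alpha$, $\alpha\le\beta$. A functor $F:\mathbf{Comp}\to\mathbf{Comp}$ is a mecw-functor if it preserves injectivity of maps, surjectivity of maps, and limits of inverse spectra over non-empty directed partially ordered sets, and $w(FX)\le w(X)$ for each infinite compactum $X$. A commutative square $p_Y\circ\tilde f=f\circ p_X$ of maps $\tilde f:\tilde X\to\tilde Y$, $p_X:\tilde X\to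 X$, $p_Y:\tilde Y\to Y$, $f:X\to Y$ between compacta is bicommutative if $\tilde f(p_X^{-1}(x))=p_Y^{-1}(f(x))$ for all $x\in X$; $F$ is preimage-preserving if it takes every bicommutative square with injective $f,\tilde f$ to a bicommutative square. Let $n=\{0,\dots,n-1\}$ be the discrete space; $F1$ is identified with its image in $F2$ under the map induced by the inclusion $1\subset 2$. Theorem 1.7. Let $F:\mathbf{Comp}\to\mathbf{Comp}$ be a preimage-preserving mecw-functor with $F1\neq F2$. A compactum $X$ is skeletally generated if and only if $FX$ is skeletally generated. -/

import Mathlib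

open CategoryTheory CategoryTheory.Limits Opposite TopologicalSpace

universe u

namespace SkeletalFunctors

/-- A map between topological spaces is skeletal if the preimage of each nowhere dense set is
nowhere dense. -/
def IsSkeletal {X Y : Type u} [TopologicalSpace X] [TopologicalSpace Y] (f : X → Y) : Prop :=
  ∀ A : Set Y, IsNowhereDense A → IsNowhereDense (f ⁻¹' A)

/-- The weight of a topological space: the smallest cardinality of a base of its topology. -/
noncomputable def weight (X : Type u) [TopologicalSpace X] : Cardinal.{u} :=
  sInf {c | ∃ B : Set (Set X), IsTopologicalBasis B ∧ Cardinal.mk B = c}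

section Spectra

/-! An inverse spectrum of compacta indexed by a partially ordered set `Λ` is a contravariant
functor `S : Λᵒᵖ ⥤ CompHaus`, that is, a family of compacta `X_α` with bonding maps
`p_α^β : X_β → X_α` for `α ≤ β`, where `p_α^α = id` and `p_α^β ∘ p_β^γ = p_α^γ`. -/

/-- The bonding map `p_α^β : X_β → X_α` for `α ≤ β`. -/
def bond {Λ : Type u} [PartialOrder Λ] (S : Λᵒᵖ ⥤ CompHaus.{u}) {α β : Λ} (h : α ≤ β) :
    S.obj (op β) ⟶ S.obj (op α) :=
  S.map (homOfLE h).op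

theorem bond_bond {Λ : Type u} [PartialOrder Λ] (S : Λᵒᵖ ⥤ CompHaus.{u}) {α β γ : Λ} (h : α ≤ β)
    (h' : β ≤ γ) (x : S.obj (op γ)) : bond S h (bond S h' x) = bond S (h.trans h') x := by
  have e : bond S (h.trans h') = bond S h' ≫ bond S h := by
    unfold bond
    rw [← S.map_comp]
    rfl
  rw [e]
  rfl

/-- The limit of an inverse spectrum: the space of threads, with the topology induced from the
product. -/
abbrev LimitSpace {Λ : Type u} [PartialOrder Λ] (S : Λᵒᵖ ⥤ CompHaus.{u}) : Type u :=
  {x : ∀ α : Λ, S.obj (op α) // ∀ (α β : Λ) (h : α ≤ β), bond S h (x β) = x α}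

/-- The restriction of an inverse spectrum to a subset of the index set. -/
def restrict {Λ : Type u} [PartialOrder Λ] (S : Λᵒᵖ ⥤ CompHaus.{u}) (T : Set Λ) :
    (↥T)ᵒᵖ ⥤ CompHaus.{u} :=
  (Subtype.mono_coe (· ∈ T)).functor.op ⋙ S

/-- For an upper bound `γ` of `T`, the canonical map `x ↦ (p_α^γ x)_{α ∈ T}` from `X_γ` to the
limit of the restriction of the spectrum to `T`. -/
def toRestrictLimit {Λ : Type u} [PartialOrder Λ] (S : Λᵒᵖ ⥤ CompHaus.{u}) (T : Set Λ) (γ : Λ)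
    (hγ : γ ∈ upperBounds T) (x : S.obj (op γ)) : LimitSpace (restrict S T) :=
  ⟨fun α => bond S (hγ α.2) x, fun α β h => bond_bond S (show α.1 ≤ β.1 from h) (hγ β.2) x⟩

/-- `ω`-spectra of compacta. Completeness (with two-element and empty subsets) makes the index set
directed and non-empty; directed subsets are non-empty by convention. -/
structure IsOmegaSpectrum {Λ : Type u} [PartialOrder Λ] (S : Λᵒᵖ ⥤ CompHaus.{u}) : Prop where
  /-- each space has countable weight -/
  countable_weight : ∀ α : Λ, SecondCountableTopology (S.obj (op α))
  /-- the index set is `ω`-complete -/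
  omega_complete : ∀ T : Set Λ, T.Countable → ∃ γ, IsLUB T γ
  /-- the spectrum is `ω`-continuous -/
  omega_continuous : ∀ T : Set Λ, T.Countable → T.Nonempty → DirectedOn (· ≤ ·) T →
    ∀ (γ : Λ) (hγ : IsLUB T γ), IsHomeomorph (toRestrictLimit S T γ hγ.1)

/-- A space is skeletally generated if it is homeomorphic to the limit of an `ω`-spectrum of
metrizable compacta with surjective skeletal bonding maps. -/
def SkeletallyGenerated (X : Type u) [TopologicalSpace X] : Prop :=
  ∃ (Λ : Type u) (_ : PartialOrder Λ) (S : Λᵒᵖ ⥤ CompHaus.{u}),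
    IsOmegaSpectrum S ∧
    (∀ α : Λ, MetrizableSpace (S.obj (op α))) ∧
    (∀ (α β : Λ) (h : α ≤ β), Function.Surjective (bond S h) ∧ IsSkeletal (bond S h)) ∧
    Nonempty (X ≃ₜ LimitSpace S)

end Spectra

section Functors

/-- The functor preserves injective maps. -/
def IsMonomorphic (F : CompHaus.{u} ⥤ CompHaus.{u}) : Prop :=
  ∀ (X Y : CompHaus.{u}) (f : X ⟶ Y), Function.Injective f → Function.Injective (F.map f)

/-- The functor preserves surjective maps. -/
def IsEpimorphic (F : CompHaus.{u} ⥤ CompHaus.{u}) : Prop :=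
  ∀ (X Y : CompHaus.{u}) (f : X ⟶ Y), Function.Surjective f → Function.Surjective (F.map f)

/-- The functor is continuous: it preserves limits of inverse spectra, indexed by (non-empty)
directed partially ordered sets. -/
def IsContinuousFunctor (F : CompHaus.{u} ⥤ CompHaus.{u}) : Prop :=
  ∀ (Λ : Type u) [PartialOrder Λ] [IsDirectedOrder Λ] [Nonempty Λ], PreservesLimitsOfShape Λᵒᵖ F

/-- The functor does not increase the weight of infinite compacta. -/
def IsWeightPreserving (F : CompHaus.{u} ⥤ CompHaus.{u}) : Prop :=
  ∀ X : CompHaus.{u}, Infinite X → weight (F.obj X) ≤ weight X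

/-- Monomorphic, epimorphic, continuous and weight-preserving functors. -/
structure IsMecw (F : CompHaus.{u} ⥤ CompHaus.{u}) : Prop where
  monomorphic : IsMonomorphic F
  epimorphic : IsEpimorphic F
  continuous : IsContinuousFunctor F
  weight_preserving : IsWeightPreserving F

/-- Bicommutativity of a square with top `f'`, left side `pX`, right side `pY`, bottom `f`. -/
def IsBicommutative {X' Y' X Y : CompHaus.{u}} (f' : X' ⟶ Y') (pX : X' ⟶ X) (pY : Y' ⟶ Y)
    (f : X ⟶ Y) : Prop :=
  ∀ x : X, f' '' (pX ⁻¹' {x}) = pY ⁻¹' {f x}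

/-- The functor preserves bicommutativity of commutative squares with injective horizontal
maps. -/
def PreservesPreimages (F : CompHaus.{u} ⥤ CompHaus.{u}) : Prop :=
  ∀ (X' Y' X Y : CompHaus.{u}) (f' : X' ⟶ Y') (pX : X' ⟶ X) (pY : Y' ⟶ Y) (f : X ⟶ Y),
    f' ≫ pY = pX ≫ f → Function.Injective f → Function.Injective f' →
    IsBicommutative f' pX pY f →
    IsBicommutative (F.map f') (F.map pX) (F.map pY) (F.map f)

/-- The discrete compactum `n = {0, …, n - 1}`. -/
abbrev finSpace (n : ℕ) : CompHaus.{u} := CompHaus.of (ULift.{u} (Fin n))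

/-- The inclusion `1 = {0} ⊆ {0, 1} = 2`. -/
def inclOneTwo : finSpace.{u} 1 ⟶ finSpace.{u} 2 :=
  CompHausLike.ofHom _ ⟨fun i => ULift.up (Fin.castLE one_le_two i.down), by fun_prop⟩

/-- The condition `F1 ≠ F2`, where `F1` is identified with a subspace of `F2` by means of the
inclusion `1 ⊆ 2`. -/
def OneNeTwo (F : CompHaus.{u} ⥤ CompHaus.{u}) : Prop :=
  Set.range (F.map inclOneTwo.{u}) ≠ Set.univ

end Functors

end SkeletalFunctors

/-! Skeletal generation can be tested on the quotients of `X` by countable sets `A` of real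
functions: it amounts to an operation `g`, sending finite sets of functions to countable sets, such
that the quotient map by every countable `g`-closed `A` is skeletal
(`exists_operation_of_skeletallyGenerated`, `skeletallyGenerated_of_isClosedUnder`). Operations can
be merged, so closed sets acquire several properties at once, and a continuous `F` carries these
quotients to a spectrum for `F X`. It remains to compare skeletality of `f` and `F f`.

From `f` to `F f` (`IsMecw.map_isSkeletal`): an irreducible zero-dimensional cover `E` of `X`
reduces an open set of `F X` to a condition on a finite clopen partition of `E`. Skeletality makes
the images of its pieces in `Y` fat, so distinct points can be chosen in their interiors; these
points support an interior point of the image. Distinctness requires `f` to be injective over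
isolated points, which a second operation arranges (`exists_operation_isolated`).

From `F f` to `f` (`IsMecw.isSkeletal_of_map`): if `f` sends an open `U` to a nowhere dense set,
elements of `F Y` with finite support off that set are dense, and their preimages under `F f` live
on the complement of `U`. Since `F1 ≠ F2`, some element of `F X` does not, which contradicts
skeletality of `F f`. -/

namespace SkeletalFunctors

/-! ### Skeletal maps -/

section Topology

/-- The form used throughout: a continuous map is skeletal when images of non-empty open sets are
somewhere dense. -/
theorem isSkeletal_iff {X Y : Type u} [TopologicalSpace X] [TopologicalSpace Y] {f : X → Y}
    (hf : Continuous f) :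
    IsSkeletal f ↔
      ∀ U : Set X, IsOpen U → U.Nonempty → (interior (closure (f '' U))).Nonempty := by
  constructor
  · intro h U hU hne
    by_contra hcon
    have h1 : interior (closure (f ⁻¹' (f '' U))) = ∅ :=
      h (f '' U) (Set.not_nonempty_iff_eq_empty.1 hcon)
    have h2 : U ⊆ interior (closure (f ⁻¹' (f '' U))) :=
      interior_maximal ((Set.subset_preimage_image f U).trans subset_closure) hU
    rw [h1] at h2
    exact hne.ne_empty (Set.subset_empty_iff.1 h2)
  · intro h A hA
    by_contra hcon
    have hne : (interior (closure (f ⁻¹' A))).Nonempty := Set.nonempty_iff_ne_empty.2 hcon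
    obtain ⟨y, hy⟩ := h _ isOpen_interior hne
    have hsub : f '' interior (closure (f ⁻¹' A)) ⊆ closure A := by
      rintro _ ⟨x, hx, rfl⟩
      exact hf.closure_preimage_subset A (interior_subset hx)
    have hy' : y ∈ interior (closure A) :=
      interior_mono (closure_minimal hsub isClosed_closure) hy
    have : interior (closure A) = ∅ := hA
    rw [this] at hy'
    exact hy'

theorem IsSkeletal.of_comp {X Y Z : Type u} [TopologicalSpace X] [TopologicalSpace Y]
    [TopologicalSpace Z] {f : X → Y} {g : Y → Z} (hf : Continuous f) (hs : Function.Surjective f)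
    (hg : Continuous g) (h : IsSkeletal (g ∘ f)) : IsSkeletal g := by
  rw [isSkeletal_iff hg]
  intro U hU hne
  have := (isSkeletal_iff (hg.comp hf)).1 h (f ⁻¹' U) (hU.preimage hf) (hne.preimage hs)
  rwa [Set.image_comp, Set.image_preimage_eq U hs] at this

/-- Skeletality of a surjection between compacta depends only on its fibres. -/
theorem IsSkeletal.congr_fibers {X Y Z : Type u} [TopologicalSpace X] [TopologicalSpace Y]
    [TopologicalSpace Z] [CompactSpace X] [T2Space Y] [T2Space Z] {p : X → Y} {q : X → Z}
    (hp : Continuous p) (hps : Function.Surjective p) (hq : Continuous q)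
    (hqs : Function.Surjective q) (h : ∀ x y, p x = p y ↔ q x = q y) (hsk : IsSkeletal p) :
    IsSkeletal q := by
  have hpq : Topology.IsQuotientMap p := hp.isClosedMap.isQuotientMap hp hps
  have hqq : Topology.IsQuotientMap q := hq.isClosedMap.isQuotientMap hq hqs
  choose s hs using hps
  let e : Y → Z := fun y => q (s y)
  have he : e ∘ p = q := funext fun x => (h _ _).1 (hs (p x))
  have hec : Continuous e := hpq.continuous_iff.2 (by rwa [he])
  have heb : Function.Bijective e := by
    constructor
    · intro a b hab
      rw [← hs a, ← hs b]
      exact (h _ _).2 hab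
    · intro z
      obtain ⟨x, rfl⟩ := hqs z
      exact ⟨p x, congrFun he x⟩
  have hpY : CompactSpace Y := ⟨by rw [← hpq.surjective.range_eq]; exact isCompact_range hp⟩
  let E : Y ≃ₜ Z := (isHomeomorph_iff_continuous_bijective.2 ⟨hec, heb⟩).homeomorph
  intro A hA
  have hEA : IsNowhereDense (E ⁻¹' A) := by
    have h0 : interior (closure A) = ∅ := hA
    change interior (closure (E ⁻¹' A)) = ∅
    rw [← E.preimage_closure, ← E.preimage_interior, h0, Set.preimage_empty]
  have := hsk _ hEA
  rw [← he]
  exact this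

end Topology

/-! ### Compactness over directed families of maps -/

section Compactness

variable {P Λ : Type u} [TopologicalSpace P] [CompactSpace P] [Preorder Λ] [IsDirectedOrder Λ]
  [Nonempty Λ] {Z : Λ → Type u} [∀ l, TopologicalSpace (Z l)] [∀ l, T2Space (Z l)]

/-- In a compact space a closed relation whose pairs are separated by some of a directed family of
maps is separated by one of them. -/
theorem exists_index_separating (π : ∀ l, P → Z l) (hπ : ∀ l, Continuous (π l))
    (hmono : ∀ l m, l ≤ m → ∀ x y, π m x = π m y → π l x = π l y) {C : Set (P × P)}
    (hC : IsClosed C) (hsep : ∀ z ∈ C, ∃ l, π l z.1 ≠ π l z.2) :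
    ∃ l, ∀ z ∈ C, π l z.1 ≠ π l z.2 := by
  by_contra! hcon
  have hcl : ∀ l, IsClosed (C ∩ {z : P × P | π l z.1 = π l z.2}) := fun l =>
    hC.inter (isClosed_eq ((hπ l).comp continuous_fst) ((hπ l).comp continuous_snd))
  obtain ⟨z, hz⟩ := IsCompact.nonempty_iInter_of_directed_nonempty_isCompact_isClosed
    (fun l => C ∩ {z : P × P | π l z.1 = π l z.2})
    (by
      intro l m
      obtain ⟨k, hk, hk'⟩ := directed_of (· ≤ ·) l m
      exact ⟨k, fun z hz => ⟨hz.1, hmono _ _ hk _ _ hz.2⟩,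
        fun z hz => ⟨hz.1, hmono _ _ hk' _ _ hz.2⟩⟩)
    (by
      intro l
      obtain ⟨z, hz, hz'⟩ := hcon l
      exact ⟨z, hz, hz'⟩)
    (fun l => (hcl l).isCompact) hcl
  rw [Set.mem_iInter] at hz
  obtain ⟨l₀⟩ := ‹Nonempty Λ›
  obtain ⟨l, hl⟩ := hsep z (hz l₀).1
  exact hl (hz l).2

/-- One index separates `x` from the whole compact set `Oᶜ`; the complement of the image of `Oᶜ` is
then the required `V`. -/
theorem exists_open_cylinder [T2Space P] (π : ∀ l, P → Z l) (hπ : ∀ l, Continuous (π l))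
    (hmono : ∀ l m, l ≤ m → ∀ x y, π m x = π m y → π l x = π l y)
    (hinj : ∀ x y, (∀ l, π l x = π l y) → x = y) {O : Set P} (hO : IsOpen O) {x : P}
    (hx : x ∈ O) :
    ∃ l, ∃ V : Set (Z l), IsOpen V ∧ π l x ∈ V ∧ π l ⁻¹' V ⊆ O := by
  obtain ⟨l, hl⟩ := exists_index_separating π hπ hmono (C := {x} ×ˢ Oᶜ)
    (isClosed_singleton.prod hO.isClosed_compl) (by
      rintro ⟨a, b⟩ ⟨ha, hb⟩
      by_contra! hcon
      have ha' : a = x := ha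
      have hab : a = b := hinj _ _ hcon
      exact hb (hab ▸ ha' ▸ hx))
  refine ⟨l, (π l '' Oᶜ)ᶜ, ?_, ?_, ?_⟩
  · exact ((hO.isClosed_compl.isCompact.image (hπ l)).isClosed).isOpen_compl
  · rintro ⟨y, hy, hyx⟩
    exact hl (x, y) ⟨rfl, hy⟩ hyx.symm
  · intro y hy
    by_contra hyO
    exact hy ⟨y, hyO, rfl⟩

/-- For each `n` one index separates all pairs on which `h` differs by at least `1 / (n + 1)`; these
countably many indices determine `h`. -/
theorem exists_countable_factor (π : ∀ l, P → Z l) (hπ : ∀ l, Continuous (π l))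
    (hmono : ∀ l m, l ≤ m → ∀ x y, π m x = π m y → π l x = π l y)
    (hinj : ∀ x y, (∀ l, π l x = π l y) → x = y) (h : C(P, ℝ)) :
    ∃ s : Set Λ, s.Countable ∧ ∀ x y, (∀ l ∈ s, π l x = π l y) → h x = h y := by
  have key : ∀ n : ℕ, ∃ l, ∀ z ∈ {z : P × P | 1 / ((n : ℝ) + 1) ≤ |h z.1 - h z.2|},
      π l z.1 ≠ π l z.2 := by
    intro n
    refine exists_index_separating π hπ hmono
      (isClosed_le continuous_const (by fun_prop)) ?_
    intro z hz
    by_contra! hcon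
    have hz' : 1 / ((n : ℝ) + 1) ≤ |h z.1 - h z.2| := hz
    rw [hinj _ _ hcon, sub_self, abs_zero] at hz'
    have : 0 < 1 / ((n : ℝ) + 1) := by positivity
    linarith
  choose l hl using key
  refine ⟨Set.range l, Set.countable_range l, ?_⟩
  intro x y hxy
  by_contra hne
  obtain ⟨n, hn⟩ := exists_nat_one_div_lt (abs_pos.2 (sub_ne_zero.2 hne))
  exact hl n (x, y) hn.le (hxy _ ⟨n, rfl⟩)

theorem exists_of_directed_surjective [T2Space P] (π : ∀ l, P → Z l) (hπ : ∀ l, Continuous (π l))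
    (hsurj : ∀ l, Function.Surjective (π l)) (z : ∀ l, Z l)
    (hz : ∀ l m, l ≤ m → ∀ x, π m x = z m → π l x = z l) : ∃ x, ∀ l, π l x = z l := by
  have hcl : ∀ l, IsClosed (π l ⁻¹' {z l}) := fun l => isClosed_singleton.preimage (hπ l)
  obtain ⟨x, hx⟩ := IsCompact.nonempty_iInter_of_directed_nonempty_isCompact_isClosed
    (fun l => π l ⁻¹' {z l})
    (by
      intro l m
      obtain ⟨k, hk, hk'⟩ := directed_of (· ≤ ·) l m
      exact ⟨k, fun x hx => hz _ _ hk _ hx, fun x hx => hz _ _ hk' _ hx⟩)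
    (fun l => (hsurj l (z l)))
    (fun l => (hcl l).isCompact) hcl
  rw [Set.mem_iInter] at hx
  exact ⟨x, hx⟩

end Compactness

/-! ### Limits of inverse spectra -/

section Limits

variable {Λ : Type u} [PartialOrder Λ]

instance (S : Λᵒᵖ ⥤ CompHaus.{u}) : CompactSpace (LimitSpace S) := by
  have : IsClosed {x : ∀ α : Λ, S.obj (op α) | ∀ (α β : Λ) (h : α ≤ β), bond S h (x β) = x α} := by
    simp only [Set.ofPred_forall]
    refine isClosed_iInter fun α => isClosed_iInter fun β => isClosed_iInter fun h => ?_
    exact isClosed_eq (by fun_prop) (by fun_prop)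
  exact isCompact_iff_compactSpace.1 this.isCompact

/-- The map to the limit space given by a cone over an inverse spectrum. -/
def coneMap {S : Λᵒᵖ ⥤ CompHaus.{u}} (c : Cone S) (x : c.pt) : LimitSpace S :=
  ⟨fun α => c.π.app (op α) x, fun α β h => by
    have := c.w (homOfLE h).op
    exact congrArg (fun g : c.pt ⟶ S.obj (op α) => g x) this⟩

theorem continuous_coneMap {S : Λᵒᵖ ⥤ CompHaus.{u}} (c : Cone S) : Continuous (coneMap c) :=
  Continuous.subtype_mk (by fun_prop) _

/-- The limit space as a cone. -/
def limitSpaceCone (S : Λᵒᵖ ⥤ CompHaus.{u}) : Cone S where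
  pt := CompHaus.of (LimitSpace S)
  π :=
    { app := fun α => CompHausLike.ofHom _ ⟨fun x => x.1 α.unop,
        (continuous_apply α.unop).comp continuous_subtype_val⟩
      naturality := by
        intro α β f
        ext x
        exact (x.2 β.unop α.unop (leOfHom f.unop)).symm }

/-- The limit space is a limit. -/
def limitSpaceConeIsLimit (S : Λᵒᵖ ⥤ CompHaus.{u}) : IsLimit (limitSpaceCone S) where
  lift c := CompHausLike.ofHom _ ⟨coneMap c, continuous_coneMap c⟩
  fac c α := rfl
  uniq c m h := by
    ext x
    refine Subtype.ext (funext fun α => ?_)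
    have := h (op α)
    exact congrArg (fun g : c.pt ⟶ S.obj (op α) => g x) this

theorem bijective_coneMap {S : Λᵒᵖ ⥤ CompHaus.{u}} {c : Cone S} (hc : IsLimit c) :
    Function.Bijective (coneMap c) := by
  let e := hc.conePointUniqueUpToIso (limitSpaceConeIsLimit S)
  have he : ∀ x, coneMap c x = e.hom x := by
    intro x
    refine Subtype.ext (funext fun α => ?_)
    have := IsLimit.conePointUniqueUpToIso_hom_comp hc (limitSpaceConeIsLimit S) (op α)
    exact (congrArg (fun g : c.pt ⟶ S.obj (op α) => g x) this).symm
  have : coneMap c = e.hom := funext he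
  rw [this]
  exact ConcreteCategory.bijective_of_isIso e.hom

theorem isHomeomorph_coneMap {S : Λᵒᵖ ⥤ CompHaus.{u}} {c : Cone S} (hc : IsLimit c) :
    IsHomeomorph (coneMap c) :=
  isHomeomorph_iff_continuous_bijective.2 ⟨continuous_coneMap c, bijective_coneMap hc⟩

/-- A cone over a directed spectrum whose projections are surjective and jointly injective is a
limit cone. -/
theorem nonempty_isLimit [IsDirectedOrder Λ] [Nonempty Λ] {S : Λᵒᵖ ⥤ CompHaus.{u}} (c : Cone S)
    (hsurj : ∀ α : Λ, Function.Surjective (c.π.app (op α)))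
    (hinj : ∀ x y : c.pt, (∀ α : Λ, c.π.app (op α) x = c.π.app (op α) y) → x = y) :
    Nonempty (IsLimit c) := by
  have hb : Function.Bijective (coneMap c) := by
    constructor
    · intro x y hxy
      exact hinj x y fun α => congrFun (congrArg Subtype.val hxy) α
    · intro z
      obtain ⟨x, hx⟩ := exists_of_directed_surjective (P := c.pt) (Z := fun α => S.obj (op α))
        (fun α x => c.π.app (op α) x)
        (fun α => by fun_prop) hsurj z.1 (by
          intro α β h x hx
          rw [← z.2 α β h, ← hx]
          exact ((coneMap c x).2 α β h).symm)
      exact ⟨x, Subtype.ext (funext hx)⟩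
  let f : c.pt ⟶ (limitSpaceCone S).pt := (limitSpaceConeIsLimit S).lift c
  have : IsIso f := CompHausLike.isIso_of_bijective f hb
  exact ⟨IsLimit.ofIsoLimit (limitSpaceConeIsLimit S)
    (Cone.ext (asIso f) fun α => rfl).symm⟩

end Limits

/-! ### Quotients of a compactum by sets of real functions -/

section FunctionSystems

variable {H : Type u} {X : CompHaus.{u}} (φ : H → C(X, ℝ))

/-- The diagonal product of the functions `φ h`, `h ∈ A`. -/
def evalMap (A : Set H) (x : X) : A → ℝ := fun h => φ h x

theorem continuous_evalMap (A : Set H) : Continuous (evalMap φ A) :=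
  continuous_pi fun h => (φ h).continuous

instance (A : Set H) : CompactSpace (Set.range (evalMap φ A)) :=
  isCompact_iff_compactSpace.1 (isCompact_range (continuous_evalMap φ A))

/-- The image of `X` under the diagonal product of the functions `φ h`, `h ∈ A`. -/
def imageSpace (A : Set H) : CompHaus.{u} := CompHaus.of (Set.range (evalMap φ A))

/-- The map of `X` onto its image. -/
def imageProj (A : Set H) : X ⟶ imageSpace φ A :=
  CompHausLike.ofHom _
    ⟨fun x => (⟨evalMap φ A x, x, rfl⟩ : Set.range (evalMap φ A)),
      (continuous_evalMap φ A).subtype_mk _⟩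

theorem imageProj_eq_iff {A : Set H} {x y : X} :
    imageProj φ A x = imageProj φ A y ↔ ∀ h ∈ A, φ h x = φ h y := by
  constructor
  · intro e h hh
    exact congrFun (congrArg Subtype.val e) ⟨h, hh⟩
  · intro e
    exact Subtype.ext (funext fun h => e h.1 h.2)

theorem imageProj_surjective (A : Set H) : Function.Surjective (imageProj φ A) := by
  rintro ⟨_, x, rfl⟩
  exact ⟨x, rfl⟩

/-- The restriction map between images, for `A ⊆ B`. -/
def imageRestrict {A B : Set H} (h : A ⊆ B) : imageSpace φ B ⟶ imageSpace φ A :=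
  CompHausLike.ofHom _
    { toFun := fun z : Set.range (evalMap φ B) =>
        (⟨fun a => z.1 ⟨a.1, h a.2⟩, by
          obtain ⟨x, hx⟩ := z.2
          exact ⟨x, by rw [← hx]; rfl⟩⟩ : Set.range (evalMap φ A))
      continuous_toFun := by
        refine Continuous.subtype_mk (continuous_pi fun a => ?_) _
        exact (continuous_apply _).comp continuous_subtype_val }

theorem imageProj_comp_imageRestrict {A B : Set H} (h : A ⊆ B) :
    imageProj φ B ≫ imageRestrict φ h = imageProj φ A := rfl

theorem imageRestrict_surjective {A B : Set H} (h : A ⊆ B) :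
    Function.Surjective (imageRestrict φ h) :=
  Function.Surjective.of_comp (g := imageProj φ B) (imageProj_surjective φ A)

theorem secondCountable_imageSpace {A : Set H} (hA : A.Countable) :
    SecondCountableTopology (imageSpace φ A) := by
  have := hA.to_subtype
  exact inferInstanceAs (SecondCountableTopology (Set.range (evalMap φ A)))

/-- The images of `X` as an inverse spectrum over all sets of indices. -/
def imageSystem : (Set H)ᵒᵖ ⥤ CompHaus.{u} where
  obj A := imageSpace φ A.unop
  map f := imageRestrict φ (leOfHom f.unop)

variable {Λ : Type u} [PartialOrder Λ]

/-- The spectrum of images over a monotone family of sets of indices. -/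
abbrev imageSpectrum (A : Λ →o Set H) : Λᵒᵖ ⥤ CompHaus.{u} :=
  A.monotone.functor.op ⋙ imageSystem φ

/-- The cone of the projections of `X` onto its images. -/
def projCone (A : Λ →o Set H) : Cone (imageSpectrum φ A) where
  pt := X
  π := { app := fun l => imageProj φ (A l.unop) }

/-- The cone of the restriction maps of the image given by an upper bound of a family of sets of
indices. -/
def restrictCone (A : Λ →o Set H) (B : Set H) (hB : ∀ l, A l ⊆ B) :
    Cone (imageSpectrum φ A) where
  pt := imageSpace φ B
  π := { app := fun l => imageRestrict φ (hB l.unop) }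

variable [IsDirectedOrder Λ] [Nonempty Λ]

theorem nonempty_isLimit_projCone (A : Λ →o Set H)
    (hsep : ∀ x y, (∀ l, ∀ h ∈ A l, φ h x = φ h y) → x = y) :
    Nonempty (IsLimit (projCone φ A)) :=
  nonempty_isLimit _ (fun l => imageProj_surjective φ (A l)) fun x y h =>
    hsep x y fun l => (imageProj_eq_iff φ).1 (h l)

theorem nonempty_isLimit_restrictCone (A : Λ →o Set H) (B : Set H) (hB : ∀ l, A l ⊆ B)
    (hB' : B ⊆ ⋃ l, A l) : Nonempty (IsLimit (restrictCone φ A B hB)) := by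
  refine nonempty_isLimit _ (fun l => imageRestrict_surjective φ (hB l)) fun x y h => ?_
  obtain ⟨x, rfl⟩ := imageProj_surjective φ B x
  obtain ⟨y, rfl⟩ := imageProj_surjective φ B y
  refine (imageProj_eq_iff φ).2 fun b hb => ?_
  obtain ⟨l, hl⟩ := Set.mem_iUnion.1 (hB' hb)
  exact (imageProj_eq_iff φ (A := A l)).1 (h l) b hl

end FunctionSystems

/-! ### Continuous functors applied to these quotients -/

section Functor

variable {G : CompHaus.{u} ⥤ CompHaus.{u}}

theorem IsContinuousFunctor.nonempty_isLimit_mapCone (hG : IsContinuousFunctor G) {Λ : Type u}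
    [PartialOrder Λ] [IsDirectedOrder Λ] [Nonempty Λ] {S : Λᵒᵖ ⥤ CompHaus.{u}} {c : Cone S}
    (hc : Nonempty (IsLimit c)) : Nonempty (IsLimit (G.mapCone c)) := by
  have := hG Λ
  obtain ⟨hc⟩ := hc
  exact ⟨isLimitOfPreserves G hc⟩

theorem map_map {A B C : CompHaus.{u}} (f : A ⟶ B) (g : B ⟶ C) (x : G.obj A) :
    G.map g (G.map f x) = G.map (f ≫ g) x := by
  rw [G.map_comp]
  rfl

variable {H : Type u} {X : CompHaus.{u}} (φ : H → C(X, ℝ)) {Λ : Type u} [PartialOrder Λ]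
  [IsDirectedOrder Λ] [Nonempty Λ]

theorem IsContinuousFunctor.map_injective (hG : IsContinuousFunctor G) (A : Λ →o Set H)
    (hsep : ∀ x y, (∀ l, ∀ h ∈ A l, φ h x = φ h y) → x = y) {u v : G.obj X}
    (h : ∀ l, G.map (imageProj φ (A l)) u = G.map (imageProj φ (A l)) v) : u = v := by
  obtain ⟨hc⟩ := hG.nonempty_isLimit_mapCone (nonempty_isLimit_projCone φ A hsep)
  exact (bijective_coneMap hc).1 (Subtype.ext (funext h))

theorem IsContinuousFunctor.map_imageProj_eq (hG : IsContinuousFunctor G) (A : Λ →o Set H)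
    (B : Set H) (hB : ∀ l, A l ⊆ B) (hB' : B ⊆ ⋃ l, A l) {u v : G.obj X}
    (h : ∀ l, G.map (imageProj φ (A l)) u = G.map (imageProj φ (A l)) v) :
    G.map (imageProj φ B) u = G.map (imageProj φ B) v := by
  obtain ⟨hc⟩ := hG.nonempty_isLimit_mapCone (nonempty_isLimit_restrictCone φ A B hB hB')
  refine (bijective_coneMap hc).1 (Subtype.ext (funext fun l => ?_))
  change G.map (imageRestrict φ (hB l)) _ = G.map (imageRestrict φ (hB l)) _
  rw [map_map, map_map]
  exact h l

end Functor

/-! ### Countable sets closed under an operation on finite sets -/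

section ClosedSets

variable {H : Type u}

/-- The set `A` is closed under the set-valued operation `g` on finite sets. -/
def IsClosedUnder (g : Finset H → Set H) (A : Set H) : Prop :=
  ∀ K : Finset H, (K : Set H) ⊆ A → g K ⊆ A

theorem countable_setOf_finset_subset {A : Set H} (hA : A.Countable) :
    {K : Finset H | (K : Set H) ⊆ A}.Countable := by
  classical
  have := hA.to_subtype
  refine (Set.countable_range fun K : Finset A => K.map (Function.Embedding.subtype _)).mono ?_
  intro K hK
  refine ⟨K.subtype (· ∈ A), ?_⟩
  exact Finset.subtype_map_of_mem hK

theorem isClosedUnder_iUnion {g : Finset H → Set H} {ι : Type*} [Nonempty ι] {A : ι → Set H}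
    (hd : Directed (· ⊆ ·) A) (hA : ∀ i, IsClosedUnder g (A i)) :
    IsClosedUnder g (⋃ i, A i) := by
  intro K hK
  obtain ⟨i, hi⟩ := hd.exists_mem_subset_of_finset_subset_biUnion hK
  exact (hA i K hi).trans (Set.subset_iUnion A i)

theorem exists_countable_isClosedUnder {g : Finset H → Set H} (hg : ∀ K, (g K).Countable)
    {A : Set H} (hA : A.Countable) :
    ∃ B : Set H, A ⊆ B ∧ B.Countable ∧ IsClosedUnder g B := by
  let step : Set H → Set H := fun B => B ∪ ⋃ K ∈ {K : Finset H | (K : Set H) ⊆ B}, g K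
  let B : ℕ → Set H := fun n => step^[n] A
  have hB : ∀ n, B (n + 1) = step (B n) := fun n => Function.iterate_succ_apply' step n A
  have hmono : Monotone B := monotone_nat_of_le_succ fun n => by
    rw [hB]
    exact Set.subset_union_left
  refine ⟨⋃ n, B n, Set.subset_iUnion B 0, Set.countable_iUnion fun n => ?_, ?_⟩
  · induction n with
    | zero => exact hA
    | succ n ih =>
      rw [hB]
      exact ih.union ((countable_setOf_finset_subset ih).biUnion fun K _ => hg K)
  · intro K hK
    obtain ⟨n, hn⟩ := hmono.directed_le.exists_mem_subset_of_finset_subset_biUnion hK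
    refine Set.Subset.trans ?_ (Set.subset_iUnion B (n + 1))
    rw [hB]
    exact (Set.subset_biUnion_of_mem (u := g) (show K ∈ {K : Finset H | (K : Set H) ⊆ B n} from
      hn)).trans Set.subset_union_right

/-- The countable sets closed under `g`. -/
abbrev ClosedIndex (g : Finset H → Set H) : Type u :=
  {A : Set H // A.Countable ∧ IsClosedUnder g A}

/-- The union need not be closed, so the supremum is the least closed set containing it, an
intersection; one countable closed upper bound makes it countable. -/
theorem ClosedIndex.exists_isLUB {g : Finset H → Set H} (hg : ∀ K, (g K).Countable)
    (T : Set (ClosedIndex g)) (hT : T.Countable) : ∃ γ, IsLUB T γ := by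
  obtain ⟨B, hAB, hBc, hB⟩ := exists_countable_isClosedUnder hg
    (hT.biUnion (t := fun A _ => A.1) fun A _ => A.2.1)
  let 𝒞 : Set (Set H) := {C | (⋃ A ∈ T, A.1) ⊆ C ∧ IsClosedUnder g C}
  refine ⟨⟨⋂₀ 𝒞, hBc.mono (Set.sInter_subset_of_mem ⟨hAB, hB⟩), ?_⟩, ?_, ?_⟩
  · intro K hK
    exact Set.subset_sInter fun C hC => hC.2 K (hK.trans (Set.sInter_subset_of_mem hC))
  · intro A hA
    exact Set.subset_sInter fun C hC =>
      (Set.subset_biUnion_of_mem (u := fun A : ClosedIndex g => A.1) hA).trans hC.1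
  · intro C hC
    exact Set.sInter_subset_of_mem ⟨Set.iUnion₂_subset fun A hA => hC hA, C.2.2⟩

/-- The operation acts on finite sets, so a directed union of closed sets is closed. This yields
`ω`-continuity of the spectrum of quotients. -/
theorem ClosedIndex.coe_isLUB {g : Finset H → Set H} {T : Set (ClosedIndex g)} (hT : T.Countable)
    (hne : T.Nonempty) (hd : DirectedOn (· ≤ ·) T) {γ : ClosedIndex g} (hγ : IsLUB T γ) :
    γ.1 = ⋃ A : T, A.1.1 := by
  have := hne.to_subtype
  have := hT.to_subtype
  have hcl : IsClosedUnder g (⋃ A : T, A.1.1) :=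
    isClosedUnder_iUnion (fun A B => by
      obtain ⟨C, hC, h, h'⟩ := hd A.1 A.2 B.1 B.2
      exact ⟨⟨C, hC⟩, h, h'⟩) fun A => A.1.2.2
  apply Set.Subset.antisymm
  · exact hγ.2 (show (⟨_, Set.countable_iUnion fun A : T => A.1.2.1, hcl⟩ : ClosedIndex g) ∈
      upperBounds T from fun A hA => Set.subset_iUnion (fun A : T => A.1.1) ⟨A, hA⟩)
  · exact Set.iUnion_subset fun A => hγ.1 A.2

end ClosedSets

/-! ### Spectra built from closed sets of functions -/

section Construction

theorem metrizableSpace_of_secondCountable (Z : Type u) [TopologicalSpace Z] [CompactSpace Z]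
    [T2Space Z] [SecondCountableTopology Z] : MetrizableSpace Z :=
  metrizableSpace_of_t3_secondCountable Z

variable {G : CompHaus.{u} ⥤ CompHaus.{u}}

/-- If the quotient maps of `X` given by the countable sets of functions closed under some
operation have skeletal images under `G`, then `G X` is skeletally generated. -/
theorem skeletallyGenerated_of_isClosedUnder (hcont : IsContinuousFunctor G)
    (hepi : IsEpimorphic G)
    (hsc : ∀ Z : CompHaus.{u}, SecondCountableTopology Z → SecondCountableTopology (G.obj Z))
    {H : Type u} {X : CompHaus.{u}} (φ : H → C(X, ℝ))
    (hsep : ∀ x y, (∀ h, φ h x = φ h y) → x = y)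
    {g : Finset H → Set H} (hg : ∀ K, (g K).Countable)
    (hsk : ∀ A : Set H, A.Countable → IsClosedUnder g A → IsSkeletal (G.map (imageProj φ A))) :
    SkeletallyGenerated (G.obj X) := by
  let ι : ClosedIndex g →o Set H := ⟨Subtype.val, Subtype.mono_coe _⟩
  have hsec : ∀ α : ClosedIndex g, SecondCountableTopology (G.obj (imageSpace φ α.1)) :=
    fun α => hsc _ (secondCountable_imageSpace φ α.2.1)
  have hlub := ClosedIndex.exists_isLUB hg
  have hdir : IsDirectedOrder (ClosedIndex g) := ⟨fun α β => by
    obtain ⟨γ, hγ⟩ := hlub {α, β} (Set.toFinite _).countable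
    exact ⟨γ, hγ.1 (by simp), hγ.1 (by simp)⟩⟩
  have hne : Nonempty (ClosedIndex g) := ⟨(hlub ∅ Set.countable_empty).choose⟩
  refine ⟨ClosedIndex g, inferInstance, imageSpectrum φ ι ⋙ G, ⟨hsec, hlub, ?_⟩, ?_, ?_, ?_⟩
  · intro T hT hTne hd γ hγ
    have := hTne.to_subtype
    have : IsDirectedOrder T := ⟨fun A B => by
      obtain ⟨C, hC, h, h'⟩ := hd A.1 A.2 B.1 B.2
      exact ⟨⟨C, hC⟩, h, h'⟩⟩
    let ιT : T →o Set H := ⟨fun A => A.1.1, fun A B h => h⟩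
    obtain ⟨hc⟩ := hcont.nonempty_isLimit_mapCone (nonempty_isLimit_restrictCone φ ιT γ.1
      (fun A => hγ.1 A.2) (ClosedIndex.coe_isLUB hT hTne hd hγ).subset)
    exact isHomeomorph_coneMap hc
  · intro α
    have := hsec α
    exact metrizableSpace_of_secondCountable (G.obj (imageSpace φ α.1))
  · intro α β h
    refine ⟨hepi _ _ _ (imageRestrict_surjective φ h), ?_⟩
    refine IsSkeletal.of_comp (f := G.map (imageProj φ β.1))
      (g := G.map (imageRestrict φ (show α.1 ⊆ β.1 from h))) (by fun_prop)
      (hepi _ _ _ (imageProj_surjective φ _)) (by fun_prop) ?_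
    have := hsk α.1 α.2.1 α.2.2
    rwa [← imageProj_comp_imageRestrict φ (show α.1 ⊆ β.1 from h), G.map_comp] at this
  · obtain ⟨hc⟩ := hcont.nonempty_isLimit_mapCone (nonempty_isLimit_projCone φ ι (by
      intro x y h
      refine hsep x y fun a => ?_
      obtain ⟨B, hB, hBc, hBg⟩ := exists_countable_isClosedUnder hg (Set.countable_singleton a)
      exact h ⟨B, hBc, hBg⟩ a (hB rfl)))
    exact ⟨(isHomeomorph_coneMap hc).homeomorph⟩

end Construction

/-! ### Countable weight -/

section Weight

theorem weight_le_aleph0 (Z : Type u) [TopologicalSpace Z] [SecondCountableTopology Z] :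
    weight Z ≤ Cardinal.aleph0 :=
  le_trans (csInf_le' (show Cardinal.mk (countableBasis Z) ∈
      {c | ∃ B : Set (Set Z), IsTopologicalBasis B ∧ Cardinal.mk B = c} from
        ⟨countableBasis Z, isBasis_countableBasis Z, rfl⟩))
    (Cardinal.le_aleph0_iff_set_countable.2 (countable_countableBasis Z))

theorem secondCountable_of_weight_le {Z : Type u} [TopologicalSpace Z]
    (h : weight Z ≤ Cardinal.aleph0) : SecondCountableTopology Z := by
  obtain ⟨B, hB, hc⟩ : weight Z ∈
      {c | ∃ B : Set (Set Z), IsTopologicalBasis B ∧ Cardinal.mk B = c} :=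
    csInf_mem ⟨_, _, isTopologicalBasis_opens, rfl⟩
  exact hB.secondCountableTopology (Cardinal.le_aleph0_iff_set_countable.1 (hc.trans_le h))

/-- The weight condition concerns infinite compacta only, so `Z` is first embedded in its disjoint
sum with a Cantor set; `F` preserves the embedding. -/
theorem IsMecw.secondCountable {F : CompHaus.{u} ⥤ CompHaus.{u}} (hF : IsMecw F)
    (Z : CompHaus.{u}) (hZ : SecondCountableTopology Z) : SecondCountableTopology (F.obj Z) := by
  have hC : SecondCountableTopology (ULift.{u} (ℕ → Bool)) :=
    Homeomorph.ulift.secondCountableTopology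
  let Z' : CompHaus.{u} := CompHaus.of (Z ⊕ ULift.{u} (ℕ → Bool))
  have hZ' : SecondCountableTopology Z' :=
    inferInstanceAs (SecondCountableTopology (Z ⊕ ULift.{u} (ℕ → Bool)))
  have hinf : Infinite Z' := inferInstanceAs (Infinite (Z ⊕ ULift.{u} (ℕ → Bool)))
  have := secondCountable_of_weight_le
    ((hF.weight_preserving Z' hinf).trans (weight_le_aleph0 Z'))
  let i : Z ⟶ Z' := CompHausLike.ofHom _ ⟨Sum.inl, continuous_inl⟩
  have hi : Function.Injective (F.map i) := hF.monomorphic _ _ i Sum.inl_injective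
  have hic : Continuous (F.map i) := by fun_prop
  exact (hic.isClosedEmbedding hi).isEmbedding.secondCountableTopology

end Weight

/-! ### Surjectivity of limit projections -/

section Limits

variable {Λ : Type u} [PartialOrder Λ] [IsDirectedOrder Λ]

theorem limitSpace_proj_surjective (S : Λᵒᵖ ⥤ CompHaus.{u})
    (hS : ∀ (α β : Λ) (h : α ≤ β), Function.Surjective (bond S h)) (α : Λ) :
    Function.Surjective fun x : LimitSpace S => x.1 α := by
  intro y
  have hne : ∀ γ, Nonempty (S.obj (op γ)) := by
    intro γ
    obtain ⟨δ, h, h'⟩ := directed_of (· ≤ ·) α γ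
    obtain ⟨z, -⟩ := hS α δ h y
    exact ⟨bond S h' z⟩
  -- Points of the product over `y` that are compatible below `β`: closed, decreasing in `β`, and
  -- non-empty by lifting `y` to level `β` and filling the other coordinates arbitrarily. Their
  -- intersection consists of threads.
  let K : Set.Ici α → Set (∀ γ : Λ, S.obj (op γ)) := fun β =>
    {x | x α = y ∧ ∀ γ (h : γ ≤ β.1), bond S h (x β) = x γ}
  have hcl : ∀ β, IsClosed (K β) := by
    intro β
    have hK : K β = {x | x α = y} ∩ ⋂ γ, ⋂ h : γ ≤ β.1, {x | bond S h (x β) = x γ} := by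
      ext x
      simp [K]
    rw [hK]
    exact (isClosed_eq (by fun_prop) (by fun_prop)).inter
      (isClosed_iInter fun γ => isClosed_iInter fun h => isClosed_eq (by fun_prop) (by fun_prop))
  have hmono : ∀ β β' : Set.Ici α, β ≤ β' → K β' ⊆ K β := by
    intro β β' h x hx
    refine ⟨hx.1, fun γ hγ => ?_⟩
    rw [← hx.2 β h, bond_bond, hx.2]
  have : Nonempty (Set.Ici α) := ⟨⟨α, Set.self_mem_Ici⟩⟩
  obtain ⟨x, hx⟩ := IsCompact.nonempty_iInter_of_directed_nonempty_isCompact_isClosed K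
    (by
      intro β β'
      obtain ⟨δ, h, h'⟩ := directed_of (· ≤ ·) β.1 β'.1
      let d : Set.Ici α := ⟨δ, β.2.trans h⟩
      exact ⟨d, hmono β d h, hmono β' d h'⟩)
    (by
      classical
      intro β
      obtain ⟨z, hz⟩ := hS α β.1 β.2 y
      refine ⟨fun γ => if h : γ ≤ β.1 then bond S h z else Classical.choice (hne γ), ?_, ?_⟩
      · beta_reduce
        rw [dif_pos (show α ≤ β.1 from β.2)]
        exact hz
      · intro γ h
        beta_reduce
        rw [dif_pos h, dif_pos le_rfl, bond_bond])
    (fun β => (hcl β).isCompact) hcl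
  rw [Set.mem_iInter] at hx
  refine ⟨⟨x, fun β γ h => ?_⟩, (hx ⟨α, Set.self_mem_Ici⟩).1⟩
  obtain ⟨δ, h1, h2⟩ := directed_of (· ≤ ·) α γ
  have hδ := (hx ⟨δ, h1⟩).2
  rw [← hδ γ h2, bond_bond, hδ β (h.trans h2)]

end Limits

/-! ### From a skeletal spectrum to an operation on functions -/

section Characterization

/-- The points of a compactum of countable weight are separated by countably many functions. -/
theorem exists_countable_separating (Z : Type u) [TopologicalSpace Z] [CompactSpace Z]
    [T2Space Z] [SecondCountableTopology Z] :
    ∃ D : Set C(Z, ℝ), D.Countable ∧ ∀ x y, (∀ h ∈ D, h x = h y) → x = y := by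
  have := metrizableSpace_of_secondCountable Z
  let := metrizableSpaceMetric Z
  obtain ⟨s, hs, hd⟩ := exists_countable_dense Z
  refine ⟨(fun d => (⟨fun x => dist x d, by fun_prop⟩ : C(Z, ℝ))) '' s, hs.image _, ?_⟩
  intro x y hxy
  by_contra hne
  obtain ⟨d, hd, hxd⟩ := hd.exists_dist_lt x (half_pos (dist_pos.2 hne))
  have h1 : dist x d = dist y d := hxy _ ⟨d, hd, rfl⟩
  have h2 := dist_triangle_right x y d
  linarith

/-- Countably many functions on `X` have the same fibres as a given map to a compactum of
countable weight. -/
theorem exists_countable_fibers {X Z : Type u} [TopologicalSpace X] [TopologicalSpace Z]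
    [CompactSpace Z] [T2Space Z] (hZ : SecondCountableTopology Z) (p : X → Z)
    (hp : Continuous p) :
    ∃ D : Set C(X, ℝ), D.Countable ∧ ∀ x y, (∀ h ∈ D, h x = h y) ↔ p x = p y := by
  obtain ⟨D, hD, hsep⟩ := exists_countable_separating Z
  refine ⟨(fun h => h.comp ⟨p, hp⟩) '' D, hD.image _, fun x y => ⟨fun h => ?_, fun h => ?_⟩⟩
  · exact hsep _ _ fun d hd => h _ ⟨d, hd, rfl⟩
  · rintro _ ⟨d, -, rfl⟩
    exact congrArg d h

/-- Every function factors through some level of the spectrum, and every level is determined by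
countably many functions. Closing `A` under this exchange makes its quotient agree with one level
`X_γ`, whose limit projection is skeletal. -/
theorem exists_operation_of_skeletallyGenerated {X : CompHaus.{u}} (hX : SkeletallyGenerated X) :
    ∃ g : Finset C(X, ℝ) → Set C(X, ℝ), (∀ K, (g K).Countable) ∧
      ∀ A : Set C(X, ℝ), A.Countable → IsClosedUnder g A →
        IsSkeletal (imageProj (fun h => h) A) := by
  classical
  obtain ⟨Λ, _, S, hS, -, hbond, ⟨e⟩⟩ := hX
  have hdir : IsDirectedOrder Λ := ⟨fun α β => by
    obtain ⟨γ, hγ⟩ := hS.omega_complete {α, β} (Set.toFinite _).countable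
    exact ⟨γ, hγ.1 (by simp), hγ.1 (by simp)⟩⟩
  have hne : Nonempty Λ := ⟨(hS.omega_complete ∅ Set.countable_empty).choose⟩
  let p : ∀ α : Λ, X → S.obj (op α) := fun α x => (e x).1 α
  have hpc : ∀ α, Continuous (p α) := fun α =>
    (continuous_apply α).comp (continuous_subtype_val.comp e.continuous)
  have hps : ∀ α, Function.Surjective (p α) := fun α =>
    (limitSpace_proj_surjective S (fun α β h => (hbond α β h).1) α).comp e.surjective
  have hpb : ∀ (α β : Λ) (h : α ≤ β) x, bond S h (p β x) = p α x := fun α β h x =>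
    (e x).2 α β h
  have hmono : ∀ α β, α ≤ β → ∀ x y, p β x = p β y → p α x = p α y := by
    intro α β h x y hxy
    rw [← hpb α β h, ← hpb α β h, hxy]
  have hinj : ∀ x y, (∀ α, p α x = p α y) → x = y := fun x y h =>
    e.injective (Subtype.ext (funext h))
  have hpsk : ∀ α, IsSkeletal (p α) := by
    intro α
    rw [isSkeletal_iff (hpc α)]
    rintro U hU ⟨x, hx⟩
    obtain ⟨β, V, hV, hxV, hVU⟩ := exists_open_cylinder p hpc hmono hinj hU hx
    obtain ⟨γ, hα, hβ⟩ := directed_of (· ≤ ·) α β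
    have h1 := (isSkeletal_iff (f := bond S hα) (by fun_prop)).1 (hbond α γ hα).2
      (bond S hβ ⁻¹' V) (hV.preimage (by fun_prop)) ⟨p γ x, by
        rw [Set.mem_preimage, hpb]
        exact hxV⟩
    refine h1.mono (interior_mono (closure_mono ?_))
    rintro _ ⟨z, hz, rfl⟩
    obtain ⟨y, rfl⟩ := hps γ z
    rw [Set.mem_preimage, hpb] at hz
    exact ⟨y, hVU hz, (hpb _ _ _ _).symm⟩
  have hfac : ∀ h : C(X, ℝ), ∃ α, ∀ x y, p α x = p α y → h x = h y := by
    intro h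
    obtain ⟨s, hs, hsh⟩ := exists_countable_factor p hpc hmono hinj h
    obtain ⟨γ, hγ⟩ := hS.omega_complete s hs
    exact ⟨γ, fun x y hxy => hsh x y fun l hl => hmono _ _ (hγ.1 hl) _ _ hxy⟩
  choose a ha using hfac
  have hsup : ∀ K : Finset C(X, ℝ), ∃ γ, IsLUB (a '' K) γ := fun K =>
    hS.omega_complete _ ((Finset.finite_toSet K).image a).countable
  choose b hb using hsup
  have hD := fun α => exists_countable_fibers (hS.countable_weight α) (p α) (hpc α)
  choose D hDc hDf using hD
  refine ⟨fun K => D (b K), fun K => hDc _, fun A hA hAg => ?_⟩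
  -- The levels attached to finite subsets of `A` form a countable directed set, so `ω`-continuity
  -- lets them determine the level of their supremum `γ`.
  let T : Set Λ := b '' {K : Finset C(X, ℝ) | (K : Set C(X, ℝ)) ⊆ A}
  have hTc : T.Countable := (countable_setOf_finset_subset hA).image b
  have hbm : ∀ K L : Finset C(X, ℝ), K ⊆ L → b K ≤ b L := fun K L h =>
    (hb K).2 fun _ hx => (hb L).1 (Set.image_mono (Finset.coe_subset.2 h) hx)
  obtain ⟨γ, hγ⟩ := hS.omega_complete T hTc
  have hhom := hS.omega_continuous T hTc ⟨b ∅, ∅, by simp, rfl⟩ (by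
    rintro _ ⟨K, hK, rfl⟩ _ ⟨L, hL, rfl⟩
    refine ⟨b (K ∪ L), ⟨K ∪ L, ?_, rfl⟩, hbm _ _ Finset.subset_union_left,
      hbm _ _ Finset.subset_union_right⟩
    change ((K ∪ L : Finset C(X, ℝ)) : Set C(X, ℝ)) ⊆ A
    rw [Finset.coe_union]
    exact Set.union_subset hK hL) γ hγ
  refine IsSkeletal.congr_fibers (hpc γ) (hps γ) (by fun_prop) (imageProj_surjective _ A) ?_
    (hpsk γ)
  intro x y
  rw [imageProj_eq_iff]
  constructor
  · intro hxy h hh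
    have h1 : b {h} ≤ γ := hγ.1 ⟨{h}, by simpa using hh, rfl⟩
    have h2 : a h ≤ b {h} := (hb {h}).1 ⟨h, by simp, rfl⟩
    exact ha h _ _ (hmono _ _ (h2.trans h1) _ _ hxy)
  · intro hxy
    apply hhom.injective
    refine Subtype.ext (funext ?_)
    rintro ⟨_, K, hK, rfl⟩
    change bond S _ (p γ x) = bond S _ (p γ y)
    rw [hpb, hpb]
    exact (hDf _ _ _).1 fun h hh => hxy h (hAg K hK hh)

end Characterization

/-! ### Preimages under the functor -/

section Preimages

variable {F : CompHaus.{u} ⥤ CompHaus.{u}}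

/-- A preimage-preserving functor takes preimages of subspaces to preimages. -/
theorem PreservesPreimages.mem_range (hpre : PreservesPreimages F) {A B X Y : CompHaus.{u}}
    (i : A ⟶ X) (hi : Function.Injective i) (k : B ⟶ Y) (hk : Function.Injective k) (f : X ⟶ Y)
    (h : ∀ x, f x ∈ Set.range k → x ∈ Set.range i) {c : F.obj X}
    (hc : F.map f c ∈ Set.range (F.map k)) : c ∈ Set.range (F.map i) := by
  have hcl : IsClosed {z : X × B | f z.1 = k z.2} :=
    isClosed_eq (by fun_prop) (by fun_prop)
  have : CompactSpace {z : X × B | f z.1 = k z.2} :=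
    isCompact_iff_compactSpace.1 hcl.isCompact
  -- The pullback of `f` and `k`: its square is bicommutative, and its projection to `X` factors
  -- through `i`.
  let P : CompHaus.{u} := CompHaus.of {z : X × B | f z.1 = k z.2}
  let p₁ : P ⟶ X := CompHausLike.ofHom _ ⟨fun z : {z : X × B | f z.1 = k z.2} => z.1.1,
    continuous_fst.comp continuous_subtype_val⟩
  let p₂ : P ⟶ B := CompHausLike.ofHom _ ⟨fun z : {z : X × B | f z.1 = k z.2} => z.1.2,
    continuous_snd.comp continuous_subtype_val⟩
  have hsq : p₁ ≫ f = p₂ ≫ k := by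
    ext z
    exact z.2
  have hp₁ : Function.Injective p₁ := by
    rintro ⟨⟨x, b⟩, hz⟩ ⟨⟨x', b'⟩, hz'⟩ (h : x = x')
    subst h
    have hb : b = b' := hk (hz.symm.trans hz')
    subst hb
    rfl
  have hbi : IsBicommutative p₁ p₂ f k := by
    intro b
    ext x
    constructor
    · rintro ⟨z, hz, rfl⟩
      have hz' : p₂ z = b := hz
      change f (p₁ z) = k b
      rw [← hz']
      exact z.2
    · intro hx
      exact ⟨(⟨(x, b), hx⟩ : {z : X × B | f z.1 = k z.2}), rfl, rfl⟩
  obtain ⟨b, hb⟩ := hc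
  have hmem : c ∈ F.map f ⁻¹' {F.map k b} := hb.symm
  rw [← hpre _ _ _ _ p₁ p₂ f k hsq hk hp₁ hbi b] at hmem
  obtain ⟨d, -, rfl⟩ := hmem
  have hic : Continuous i := by fun_prop
  have hemb := (hic.isClosedEmbedding hi).isEmbedding
  choose s hs using fun z : P => h (p₁ z) ⟨p₂ z, (congrArg (fun g : P ⟶ Y => g z) hsq).symm⟩
  have hsc : Continuous s := by
    rw [hemb.continuous_iff]
    have : i ∘ s = p₁ := funext hs
    rw [this]
    fun_prop
  let t : P ⟶ A := CompHausLike.ofHom _ ⟨s, hsc⟩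
  have ht : t ≫ i = p₁ := by
    ext z
    exact hs z
  exact ⟨F.map t d, by rw [map_map, ht]⟩

end Preimages

section Separation

theorem regularSpace_of_compact (Z : Type u) [TopologicalSpace Z] [CompactSpace Z] [T2Space Z] :
    RegularSpace Z := inferInstance

theorem totallySeparatedSpace_of_compact (Z : Type u) [TopologicalSpace Z] [CompactSpace Z]
    [T2Space Z] [TotallyDisconnectedSpace Z] : TotallySeparatedSpace Z := inferInstance

instance (Z : CompHaus.{u}) : T1Space Z := T2Space.t1Space

instance (Z : CompHaus.{u}) : RegularSpace Z := regularSpace_of_compact Z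

end Separation

/-! ### Irreducible zero-dimensional covers and finite supports -/

section ZeroDimensional

variable {F : CompHaus.{u} ⥤ CompHaus.{u}}

/-- `E` is the limit of its finite quotients given by clopen sets, and `F` preserves this limit, so
open sets of `F E` contain cylinders over finite stages. -/
theorem IsContinuousFunctor.exists_finite_quotient (hF : IsContinuousFunctor F) (E : CompHaus.{u})
    [TotallyDisconnectedSpace E] {O : Set (F.obj E)} (hO : IsOpen O) {u : F.obj E} (hu : u ∈ O) :
    ∃ (R : CompHaus.{u}) (r : E ⟶ R) (V : Set (F.obj R)), Finite R ∧ Function.Surjective r ∧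
      IsOpen V ∧ F.map r u ∈ V ∧ F.map r ⁻¹' V ⊆ O := by
  classical
  have := totallySeparatedSpace_of_compact E
  let H : Type u := {C : Set E // IsClopen C}
  let φ : H → C(E, ℝ) := fun C => (LocallyConstant.charFn ℝ C.2 : C(E, ℝ))
  have hφ : ∀ C x, φ C x = Set.indicator C.1 1 x := fun C x => rfl
  let A : Finset H →o Set H := ⟨fun K => K, fun K L h => Finset.coe_subset.2 h⟩
  have hsep : ∀ x y, (∀ K, ∀ C ∈ A K, φ C x = φ C y) → x = y := by
    intro x y h
    by_contra hne
    obtain ⟨C, hC, hx, hy⟩ := exists_isClopen_of_totally_separated hne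
    have := h {⟨C, hC⟩} ⟨C, hC⟩ (Finset.mem_singleton_self _)
    rw [hφ, hφ, Set.indicator_of_mem hx, Set.indicator_of_notMem hy] at this
    exact one_ne_zero this
  have hmono : ∀ K L : Finset H, K ≤ L → ∀ u v : F.obj E,
      F.map (imageProj φ (A L)) u = F.map (imageProj φ (A L)) v →
      F.map (imageProj φ (A K)) u = F.map (imageProj φ (A K)) v := by
    intro K L h u v huv
    rw [← imageProj_comp_imageRestrict φ (A.monotone h), ← map_map, ← map_map, huv]
  obtain ⟨K, V, hV, huV, hVO⟩ := exists_open_cylinder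
    (fun (K : Finset H) u => F.map (imageProj φ (A K)) u) (fun K => by fun_prop) hmono
    (fun u v h => hF.map_injective φ A hsep h) hO hu
  refine ⟨imageSpace φ (A K), imageProj φ (A K), V, ?_, imageProj_surjective _ _, hV, huV, hVO⟩
  have hfin : (Set.range (evalMap φ (A K))).Finite := by
    have : Finite (A K) := inferInstanceAs (Finite (K : Set H))
    refine (Set.Finite.pi' fun _ : A K => Set.toFinite ({0, 1} : Set ℝ)).subset ?_
    rintro _ ⟨x, rfl⟩ C
    by_cases hx : x ∈ C.1.1
    · exact Or.inr ((hφ _ _).trans (Set.indicator_of_mem hx _))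
    · exact Or.inl ((hφ _ _).trans (Set.indicator_of_notMem hx _))
  exact hfin.to_subtype

/-- A surjection is irreducible if it maps no proper closed subset onto its codomain. -/
def IsIrreducibleMap {X Y : Type u} [TopologicalSpace X] (f : X → Y) : Prop :=
  Function.Surjective f ∧ ∀ C : Set X, IsClosed C → f '' C = Set.univ → C = Set.univ

/-- The ultrafilter space on the points of `X` maps onto `X`; a minimal closed subset that still
covers `X` gives an irreducible map. -/
theorem exists_irreducible_cover (X : CompHaus.{u}) :
    ∃ (E : CompHaus.{u}) (π : E ⟶ X), TotallyDisconnectedSpace E ∧ IsIrreducibleMap π := by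
  have hc : Continuous (Ultrafilter.extend (id : X → X)) := continuous_ultrafilter_extend id
  have hs : Function.Surjective (Ultrafilter.extend (id : X → X)) := fun x =>
    ⟨pure x, congrFun (ultrafilter_extend_extends id) x⟩
  obtain ⟨E, hE, hEs, hEi⟩ := exists_compact_surjective_zorn_subset hc hs
  refine ⟨CompHaus.of E, CompHausLike.ofHom _ ⟨fun e : E => Ultrafilter.extend id e.1,
    hc.comp continuous_subtype_val⟩, inferInstanceAs (TotallyDisconnectedSpace E), ?_, ?_⟩
  · intro x
    obtain ⟨e, he, hx⟩ : x ∈ Ultrafilter.extend id '' E := by rw [hEs]; trivial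
    exact ⟨⟨e, he⟩, hx⟩
  · intro C hC hCu
    by_contra hne
    exact hEi C hne hC hCu

theorem IsIrreducibleMap.nonempty_interior_image {X Y : Type u} [TopologicalSpace X]
    [TopologicalSpace Y] [CompactSpace X] [T2Space Y] {f : X → Y} (hf : IsIrreducibleMap f)
    (hc : Continuous f) {U : Set X} (hU : IsOpen U) (hne : U.Nonempty) :
    (interior (f '' U)).Nonempty := by
  have hopen : IsOpen (f '' Uᶜ)ᶜ := (hU.isClosed_compl.isCompact.image hc).isClosed.isOpen_compl
  have hsub : (f '' Uᶜ)ᶜ ⊆ f '' U := by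
    intro y hy
    obtain ⟨x, rfl⟩ := hf.1 y
    refine ⟨x, ?_, rfl⟩
    by_contra hx
    exact hy ⟨x, hx, rfl⟩
  refine Set.Nonempty.mono (interior_maximal hsub hopen) ?_
  rw [Set.nonempty_compl]
  intro h
  have := hf.2 _ hU.isClosed_compl h
  obtain ⟨x, hx⟩ := hne
  exact (this ▸ Set.mem_univ x : x ∈ Uᶜ) hx

/-- Elements of `F Y` supported by finite sets that avoid a nowhere dense closed set are dense. -/
theorem IsContinuousFunctor.exists_finite_support (hF : IsContinuousFunctor F)
    (hepi : IsEpimorphic F) {Y : CompHaus.{u}} {N : Set Y} (hN : interior N = ∅)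
    {W : Set (F.obj Y)} (hW : IsOpen W) (hne : W.Nonempty) :
    ∃ (R : CompHaus.{u}) (k : R ⟶ Y) (a : F.obj R), (∀ i, k i ∉ N) ∧ F.map k a ∈ W := by
  obtain ⟨E, π, hE, hπ⟩ := exists_irreducible_cover Y
  obtain ⟨w, hw⟩ := hne
  obtain ⟨u, rfl⟩ := hepi _ _ π hπ.1 w
  obtain ⟨R, r, V, hR, hr, hV, huV, hVW⟩ := hF.exists_finite_quotient E
    (hW.preimage (f := F.map π) (by fun_prop)) hw
  have : DiscreteTopology R := inferInstance
  -- Each piece of the partition has an image with non-empty interior, hence a point whose image is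
  -- off `N`. These points give a section of `r`.
  have hsec : ∀ i : R, ∃ e, r e = i ∧ π e ∉ N := by
    intro i
    by_contra! hcon
    obtain ⟨y, hy⟩ := hπ.nonempty_interior_image (by fun_prop)
      ((isOpen_discrete {i}).preimage (f := r) (by fun_prop)) (hr i)
    have hsub : π '' (r ⁻¹' {i}) ⊆ N := by
      rintro _ ⟨e, he, rfl⟩
      exact hcon e he
    have := interior_mono hsub hy
    rw [hN] at this
    exact this
  choose s hs hsN using hsec
  let σ : R ⟶ E := CompHausLike.ofHom _ ⟨s, continuous_of_discreteTopology⟩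
  have hσ : σ ≫ r = 𝟙 R := by
    ext i
    exact hs i
  refine ⟨R, σ ≫ π, F.map r u, hsN, ?_⟩
  rw [← map_map]
  apply hVW
  rw [Set.mem_preimage, map_map, hσ, F.map_id]
  exact huV

end ZeroDimensional

/-! ### Distinct representatives -/

section DistinctRepresentatives

theorem exists_injective_mem_interior {R Y : Type u} [Finite R] [TopologicalSpace Y] [T1Space Y]
    (C : R → Set Y) (hC : ∀ i, (interior (C i)).Nonempty)
    (hiso : ∀ y, IsOpen {y} → ∀ i j, y ∈ C i → y ∈ C j → i = j) :
    ∃ y : R → Y, Function.Injective y ∧ ∀ i, y i ∈ interior (C i) := by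
  classical
  have := Fintype.ofFinite R
  have key : ∀ s : Finset R, ∃ y : R → Y, Set.InjOn y s ∧ ∀ i ∈ s, y i ∈ interior (C i) := by
    intro s
    induction s using Finset.induction_on with
    | empty => exact ⟨fun i => (hC i).choose, by simp, by simp⟩
    | insert i s hi ih =>
      obtain ⟨y, hy, hyC⟩ := ih
      obtain ⟨z, hz, hzs⟩ : ∃ z ∈ interior (C i), z ∉ y '' s := by
        by_contra! hcon
        -- With no new point available, the interior is finite, so its points are isolated, and an
        -- isolated point lies in only one of the sets.
        have hfin : (interior (C i)).Finite :=
          (s.finite_toSet.image y).subset hcon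
        obtain ⟨z, hz⟩ := hC i
        have hopen : IsOpen {z} := by
          have : {z} = interior (C i) \ (interior (C i) \ {z}) := by
            ext w
            simp only [Set.mem_singleton_iff, Set.mem_sdiff, not_and, not_not]
            exact ⟨fun h => ⟨h.symm ▸ hz, fun _ => h⟩, fun h => h.2 h.1⟩
          rw [this]
          exact isOpen_interior.sdiff (hfin.subset Set.sdiff_subset).isClosed
        obtain ⟨j, hj, rfl⟩ := hcon z hz
        have := hiso _ hopen i j (interior_subset hz) (interior_subset (hyC j hj))
        exact hi (this ▸ hj)
      have hne : ∀ j ∈ s, j ≠ i := fun j hj h => hi (h ▸ hj)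
      refine ⟨Function.update y i z, ?_, ?_⟩
      · intro j hj k hk hjk
        rcases Finset.mem_insert.1 hj with rfl | hj' <;> rcases Finset.mem_insert.1 hk with rfl | hk'
        · rfl
        · rw [Function.update_self, Function.update_of_ne (hne k hk')] at hjk
          exact absurd ⟨k, hk', hjk.symm⟩ hzs
        · rw [Function.update_self, Function.update_of_ne (hne j hj')] at hjk
          exact absurd ⟨j, hj', hjk⟩ hzs
        · rw [Function.update_of_ne (hne j hj'), Function.update_of_ne (hne k hk')] at hjk
          exact hy hj' hk' hjk
      · intro j hj
        rcases Finset.mem_insert.1 hj with rfl | hj'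
        · rwa [Function.update_self]
        · rw [Function.update_of_ne (hne j hj')]
          exact hyC j hj'
  obtain ⟨y, hy, hyC⟩ := key Finset.univ
  exact ⟨y, fun i j h => hy (by simp) (by simp) h, fun i => hyC i (Finset.mem_univ i)⟩

end DistinctRepresentatives

/-! ### Skeletality of `f` versus that of `F f` -/

section SkeletalImages

variable {F : CompHaus.{u} ⥤ CompHaus.{u}}

/-- The open set `W`, the complement of `F pT ((F rT)⁻¹ Vᶜ)`, lies in the image of `O` because `E'`
covers `Y`. It contains `F yR (F r u)`: `pT` has a single point over each `y i`, so preimage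
preservation forces every lift to `F T` to come from `F R`. -/
theorem IsMecw.map_isSkeletal (hF : IsMecw F) (hpre : PreservesPreimages F) {X Y : CompHaus.{u}}
    (f : X ⟶ Y) (hf : Function.Surjective f) (hsk : IsSkeletal f)
    (hiso : ∀ x x', IsOpen {f x} → f x' = f x → x' = x) : IsSkeletal (F.map f) := by
  rw [isSkeletal_iff (by fun_prop)]
  rintro O hO ⟨o, ho⟩
  obtain ⟨E, π, hE, hπ⟩ := exists_irreducible_cover X
  obtain ⟨u, rfl⟩ := hF.epimorphic _ _ π hπ.1 o
  obtain ⟨R, r, V, hR, hr, hV, huV, hVO⟩ := hF.continuous.exists_finite_quotient E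
    (hO.preimage (f := F.map π) (by fun_prop)) ho
  have : DiscreteTopology R := inferInstance
  have hopen : ∀ i, IsOpen (r ⁻¹' {i}) := fun i =>
    (isOpen_discrete {i}).preimage (by fun_prop)
  let C : R → Set Y := fun i => f '' (π '' (r ⁻¹' {i}))
  have hCcl : ∀ i, IsClosed (C i) := fun i =>
    ((((isClosed_discrete {i}).preimage (f := r) (by fun_prop)).isCompact.image
      (f := π) (by fun_prop)).image (f := f) (by fun_prop)).isClosed
  have hCne : ∀ i, (interior (C i)).Nonempty := by
    intro i
    have h1 := hπ.nonempty_interior_image (by fun_prop) (hopen i) (hr i)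
    refine ((isSkeletal_iff (by fun_prop)).1 hsk _ isOpen_interior h1).mono (interior_mono ?_)
    exact closure_minimal (Set.image_mono interior_subset) (hCcl i)
  obtain ⟨y, hyinj, hy⟩ := exists_injective_mem_interior C hCne (by
    rintro _ hyo i j ⟨x, ⟨e, he, rfl⟩, rfl⟩ ⟨x', ⟨e', he', rfl⟩, hx'⟩
    have hx : π e' = π e := hiso _ _ hyo hx'
    by_contra hij
    have hfib : IsOpen (π ⁻¹' (f ⁻¹' {f (π e)})) :=
      (hyo.preimage (by fun_prop)).preimage (by fun_prop)
    -- Over an isolated point the fibre of `f` is one point. If it met two pieces, the part of its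
    -- preimage in piece `i` could be deleted from `E`, against irreducibility.
    have := hπ.2 (π ⁻¹' (f ⁻¹' {f (π e)}) ∩ r ⁻¹' {i})ᶜ (hfib.inter (hopen i)).isClosed_compl (by
      refine Set.eq_univ_of_forall fun z => ?_
      obtain ⟨d, rfl⟩ := hπ.1 z
      by_cases hd : f (π d) = f (π e)
      · refine ⟨e', fun h => hij ?_, hx.trans (hiso _ _ hyo hd).symm⟩
        exact (show r e' = i from h.2).symm.trans he'
      · exact ⟨d, fun h => hd h.1, rfl⟩)
    have hmem : e ∈ (π ⁻¹' (f ⁻¹' {f (π e)}) ∩ r ⁻¹' {i})ᶜ := this ▸ Set.mem_univ e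
    exact hmem ⟨rfl, he⟩)
  obtain ⟨U, hU, hUd⟩ := (Set.finite_range y).t2_separation
  let v : R → Set Y := fun i => U (y i) ∩ interior (C i)
  have hvo : ∀ i, IsOpen (v i) := fun i => (hU _).2.inter isOpen_interior
  have hyv : ∀ i, y i ∈ v i := fun i => ⟨(hU _).1, hy i⟩
  have hvd : ∀ i j z, z ∈ v i → z ∈ v j → i = j := by
    intro i j z hi hj
    by_contra hij
    exact Set.disjoint_left.1 (hUd ⟨i, rfl⟩ ⟨j, rfl⟩ (hyinj.ne hij)) hi.1 hj.1
  -- pairs `(z, i)` such that `i` is the index of the set `v j` containing `z`, if there is one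
  have hTcl : IsClosed {t : Y × R | ∀ i, t.1 ∈ v i → t.2 = i} := by
    simp only [Set.ofPred_forall]
    refine isClosed_iInter fun i => ?_
    exact isClosed_imp ((hvo i).preimage continuous_fst) (isClosed_eq continuous_snd continuous_const)
  have : CompactSpace {t : Y × R | ∀ i, t.1 ∈ v i → t.2 = i} :=
    isCompact_iff_compactSpace.1 hTcl.isCompact
  let T : CompHaus.{u} := CompHaus.of {t : Y × R | ∀ i, t.1 ∈ v i → t.2 = i}
  let pT : T ⟶ Y := CompHausLike.ofHom _
    ⟨fun t : {t : Y × R | ∀ i, t.1 ∈ v i → t.2 = i} => t.1.1,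
      continuous_fst.comp continuous_subtype_val⟩
  let rT : T ⟶ R := CompHausLike.ofHom _
    ⟨fun t : {t : Y × R | ∀ i, t.1 ∈ v i → t.2 = i} => t.1.2,
      continuous_snd.comp continuous_subtype_val⟩
  let yR : R ⟶ Y := CompHausLike.ofHom _ ⟨y, continuous_of_discreteTopology⟩
  let sR : R ⟶ T := CompHausLike.ofHom _
    ⟨fun i => (⟨(y i, i), fun j hj => hvd i j _ (hyv i) hj⟩ :
      {t : Y × R | ∀ i, t.1 ∈ v i → t.2 = i}), continuous_of_discreteTopology⟩
  have hsp : sR ≫ pT = yR := rfl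
  have hsr : sR ≫ rT = 𝟙 R := rfl
  have hscl : IsClosed {e : E | ∀ i, f (π e) ∈ v i → r e = i} := by
    simp only [Set.ofPred_forall]
    refine isClosed_iInter fun i => ?_
    exact isClosed_imp ((hvo i).preimage (by fun_prop)) (isClosed_eq (by fun_prop) continuous_const)
  have : CompactSpace {e : E | ∀ i, f (π e) ∈ v i → r e = i} :=
    isCompact_iff_compactSpace.1 hscl.isCompact
  -- Over each `v i` only piece `i` is kept; as `v i ⊆ C i`, the rest still covers `Y`.
  let E' : CompHaus.{u} := CompHaus.of {e : E | ∀ i, f (π e) ∈ v i → r e = i}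
  let j : E' ⟶ E := CompHausLike.ofHom _
    ⟨fun e : {e : E | ∀ i, f (π e) ∈ v i → r e = i} => e.1, continuous_subtype_val⟩
  let t : E' ⟶ T := CompHausLike.ofHom _
    ⟨fun e : {e : E | ∀ i, f (π e) ∈ v i → r e = i} =>
      (⟨(f (π e.1), r e.1), e.2⟩ : {t : Y × R | ∀ i, t.1 ∈ v i → t.2 = i}),
      Continuous.subtype_mk (by fun_prop) _⟩
  have hj : Function.Surjective (j ≫ π ≫ f) := by
    intro z
    by_cases hz : ∃ i, z ∈ v i
    · obtain ⟨i, hi⟩ := hz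
      obtain ⟨_, ⟨e, he, rfl⟩, rfl⟩ := interior_subset hi.2
      exact ⟨(⟨e, fun k hk => (show r e = i from he).trans (hvd _ _ _ hi hk)⟩ :
        {e : E | ∀ i, f (π e) ∈ v i → r e = i}), rfl⟩
    · obtain ⟨x, rfl⟩ := hf z
      obtain ⟨e, rfl⟩ := hπ.1 x
      exact ⟨(⟨e, fun k hk => (hz ⟨k, hk⟩).elim⟩ :
        {e : E | ∀ i, f (π e) ∈ v i → r e = i}), rfl⟩
  have hWo : IsOpen (F.map pT '' (F.map rT ⁻¹' V)ᶜ)ᶜ :=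
    ((((hV.preimage (f := F.map rT) (by fun_prop)).isClosed_compl).isCompact.image
      (f := F.map pT) (by fun_prop)).isClosed).isOpen_compl
  refine ⟨F.map yR (F.map r u), interior_maximal ?_ hWo ?_⟩
  · intro b hb
    obtain ⟨c, rfl⟩ := hF.epimorphic _ _ _ hj b
    have hd : F.map rT (F.map t c) ∈ V := by
      by_contra hd
      exact hb ⟨F.map t c, hd, by rw [map_map]; rfl⟩
    have hc : F.map j c ∈ F.map π ⁻¹' O := hVO (by
      rw [Set.mem_preimage, map_map]
      rwa [map_map] at hd)
    exact subset_closure ⟨_, hc, by rw [map_map, map_map]⟩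
  · rintro ⟨d, hd, hdy⟩
    obtain ⟨a, rfl⟩ := hpre.mem_range sR (fun i i' h => congrArg rT h) yR hyinj pT (by
      rintro ⟨⟨z, i⟩, hz⟩ ⟨k, hk : y k = z⟩
      subst hk
      have : i = k := hz k (hyv k)
      subst this
      exact ⟨i, rfl⟩) ⟨F.map r u, hdy.symm⟩
    rw [map_map, hsp] at hdy
    have ha : a = F.map r u := hF.monomorphic _ _ yR hyinj hdy
    apply hd
    rw [Set.mem_preimage, map_map, hsr, F.map_id, ha]
    exact huV

/-- Otherwise preimage preservation along `2 → 1` makes all of `F2` come from the empty space, hence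
from `F1`. -/
theorem exists_notMem_range_empty (hpre : PreservesPreimages F) (hne : OneNeTwo F) :
    ∃ e : F.obj (finSpace 1), ∀ (Z : CompHaus.{u}) (k : Z ⟶ finSpace 1), IsEmpty Z →
      e ∉ Set.range (F.map k) := by
  by_contra! hcon
  apply hne
  refine Set.eq_univ_of_forall fun c => ?_
  let f : finSpace.{u} 2 ⟶ finSpace 1 := CompHausLike.ofHom _ ⟨fun _ => ⟨0⟩, continuous_const⟩
  obtain ⟨Z, k, hZ, hk⟩ := hcon (F.map f c)
  obtain ⟨d, rfl⟩ := hpre.mem_range (k ≫ inclOneTwo) (fun z => hZ.elim z) k (fun z => hZ.elim z) f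
    (by rintro _ ⟨z, -⟩; exact hZ.elim z) hk
  exact ⟨F.map k d, by rw [map_map]⟩

theorem IsMecw.isSkeletal_of_map (hF : IsMecw F) (hpre : PreservesPreimages F) (hne : OneNeTwo F)
    {X Y : CompHaus.{u}} (f : X ⟶ Y) (hsk : IsSkeletal (F.map f)) : IsSkeletal f := by
  rw [isSkeletal_iff (by fun_prop)]
  rintro U hU ⟨x₀, hx₀⟩
  by_contra hcon
  rw [Set.not_nonempty_iff_eq_empty] at hcon
  obtain ⟨e, he⟩ := exists_notMem_range_empty hpre hne
  have : CompactSpace ↥Uᶜ := isCompact_iff_compactSpace.1 hU.isClosed_compl.isCompact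
  let i : CompHaus.of ↥Uᶜ ⟶ X := CompHausLike.ofHom _ ⟨Subtype.val, continuous_subtype_val⟩
  let pt : finSpace.{u} 1 ⟶ X := CompHausLike.ofHom _ ⟨fun _ => x₀, continuous_const⟩
  have hpt : F.map pt e ∉ Set.range (F.map i) := by
    intro h
    let k : CompHaus.of PEmpty.{u + 1} ⟶ finSpace.{u} 1 :=
      CompHausLike.ofHom _ ⟨PEmpty.elim, continuous_of_discreteTopology⟩
    refine he _ k inferInstance (hpre.mem_range k (fun z => z.elim) i Subtype.val_injective pt ?_ h)
    rintro x ⟨z, hz⟩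
    exact (z.2 ((show z.1 = x₀ from hz) ▸ hx₀)).elim
  have hrcl : IsClosed (Set.range (F.map i)) := (isCompact_range (by fun_prop)).isClosed
  obtain ⟨t, ht, htcl, hti⟩ := exists_mem_nhds_isClosed_subset (hrcl.isOpen_compl.mem_nhds hpt)
  have hW := (isSkeletal_iff (by fun_prop)).1 hsk _ isOpen_interior
    ⟨_, mem_interior_iff_mem_nhds.2 ht⟩
  obtain ⟨R, k, a, hkN, hka⟩ := hF.continuous.exists_finite_support hF.epimorphic
    (N := closure (f '' U)) hcon isOpen_interior hW
  have hcl : IsClosed (F.map f '' t) := (htcl.isCompact.image (by fun_prop)).isClosed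
  obtain ⟨c, hc, hck⟩ := closure_minimal (Set.image_mono interior_subset) hcl (interior_subset hka)
  have : CompactSpace (Set.range k) :=
    isCompact_iff_compactSpace.1 (isCompact_range (by fun_prop))
  let k₁ : R ⟶ CompHaus.of (Set.range k) :=
    CompHausLike.ofHom _ ⟨fun z => ⟨k z, z, rfl⟩, Continuous.subtype_mk (by fun_prop) _⟩
  let k₂ : CompHaus.of (Set.range k) ⟶ Y :=
    CompHausLike.ofHom _ ⟨Subtype.val, continuous_subtype_val⟩
  have hk : k₁ ≫ k₂ = k := rfl
  refine hti hc (hpre.mem_range i Subtype.val_injective k₂ Subtype.val_injective f ?_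
    ⟨F.map k₁ a, by rw [hck, map_map, hk]⟩)
  rintro x ⟨⟨_, z, rfl⟩, hz : k z = f x⟩
  exact ⟨⟨x, fun hx => hkN z (hz ▸ subset_closure ⟨x, hx, rfl⟩)⟩, rfl⟩

end SkeletalImages

/-! ### Finite sets of functions and isolated points of quotients -/

section FiniteSubsets

/-- The finite subsets of a set. -/
abbrev FinsetsIn {H : Type u} (A : Set H) : Type u := {K : Finset H // (K : Set H) ⊆ A}

instance {H : Type u} (A : Set H) : Nonempty (FinsetsIn A) := ⟨⟨∅, by simp⟩⟩

instance {H : Type u} (A : Set H) : IsDirectedOrder (FinsetsIn A) := by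
  classical
  refine ⟨fun K L => ⟨⟨K.1 ∪ L.1, ?_⟩, Finset.subset_union_left, Finset.subset_union_right⟩⟩
  rw [Finset.coe_union]
  exact Set.union_subset K.2 L.2

/-- The inclusion of the finite subsets of a set into all subsets. -/
def finsetsInHom {H : Type u} (A : Set H) : FinsetsIn A →o Set H :=
  ⟨fun K => K.1, fun _ _ h => Finset.coe_subset.2 h⟩

theorem subset_iUnion_finsetsInHom {H : Type u} (A : Set H) : A ⊆ ⋃ K, finsetsInHom A K :=
  fun a ha => Set.mem_iUnion.2 ⟨⟨{a}, by simpa using ha⟩, Finset.mem_singleton_self a⟩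

end FiniteSubsets

theorem exists_continuousMap_ne {X : Type u} [TopologicalSpace X] [CompactSpace X] [T2Space X]
    {x y : X} (h : x ≠ y) : ∃ f : C(X, ℝ), f x ≠ f y := by
  obtain ⟨f, h0, h1, -⟩ := exists_continuous_zero_one_of_isClosed (isClosed_singleton (x := x))
    (isClosed_singleton (x := y)) (Set.disjoint_singleton.2 h)
  refine ⟨f, ?_⟩
  rw [h0 rfl, h1 rfl]
  exact zero_ne_one

/-- An operation such that the quotient maps given by closed sets of functions are injective over
isolated points. -/
theorem exists_operation_isolated (X : CompHaus.{u}) :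
    ∃ g : Finset C(X, ℝ) → Set C(X, ℝ), (∀ K, (g K).Countable) ∧
      ∀ A : Set C(X, ℝ), IsClosedUnder g A → ∀ x x',
        IsOpen {imageProj (fun h => h) A x} →
        imageProj (fun h => h) A x' = imageProj (fun h => h) A x → x' = x := by
  -- `w W` is non-constant on `W` unless `W` has at most one point, so a fibre containing `W` on
  -- which `w W` is constant forces `W` to be trivial.
  have hW : ∀ W : Set X, ∃ h : C(X, ℝ), (∀ x ∈ W, ∀ y ∈ W, h x = h y) → ∀ x ∈ W, ∀ y ∈ W, x = y := by
    intro W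
    by_cases h : ∃ x ∈ W, ∃ y ∈ W, x ≠ y
    · obtain ⟨x, hx, y, hy, hxy⟩ := h
      obtain ⟨f, hf⟩ := exists_continuousMap_ne hxy
      exact ⟨f, fun h => (hf (h x hx y hy)).elim⟩
    · push Not at h
      exact ⟨0, fun _ => h⟩
  choose w hw using hW
  let φ : C(X, ℝ) → C(X, ℝ) := fun h => h
  have hsc : ∀ K : Finset C(X, ℝ), SecondCountableTopology (imageSpace φ (K : Set C(X, ℝ))) :=
    fun K => secondCountable_imageSpace φ K.countable_toSet
  refine ⟨fun K => (fun V => w (imageProj φ (K : Set C(X, ℝ)) ⁻¹' V)) ''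
    countableBasis (imageSpace φ (K : Set C(X, ℝ))),
    fun K => (countable_countableBasis _).image _, ?_⟩
  intro A hA x x' hopen hx
  obtain ⟨K, V, hV, hxV, hVO⟩ := exists_open_cylinder (P := imageSpace φ A)
    (Z := fun K : FinsetsIn A => imageSpace φ (K.1 : Set C(X, ℝ)))
    (fun K z => imageRestrict φ K.2 z) (fun K => by fun_prop)
    (by
      intro K L h z z' hz
      exact congrArg (imageRestrict φ (Finset.coe_subset.2 h)) hz)
    (by
      intro z z' h
      obtain ⟨a, rfl⟩ := imageProj_surjective φ A z
      obtain ⟨b, rfl⟩ := imageProj_surjective φ A z'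
      refine (imageProj_eq_iff φ).2 fun f hf => ?_
      exact (imageProj_eq_iff φ (A := (({f} : Finset C(X, ℝ)) : Set C(X, ℝ)))).1
        (h ⟨{f}, by simpa using hf⟩) f (by simp))
    hopen (Set.mem_singleton _)
  obtain ⟨V', hV', hxV', hVV'⟩ := (isBasis_countableBasis _).exists_subset_of_mem_open hxV hV
  have hmem : w (imageProj φ (K.1 : Set C(X, ℝ)) ⁻¹' V') ∈ A := hA K.1 K.2 ⟨V', hV', rfl⟩
  have hfib : ∀ z ∈ imageProj φ (K.1 : Set C(X, ℝ)) ⁻¹' V', imageProj φ A z = imageProj φ A x :=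
    fun z hz => hVO (hVV' hz)
  refine hw (imageProj φ (K.1 : Set C(X, ℝ)) ⁻¹' V') (fun a ha b hb => ?_) x' ?_ x hxV'
  · exact (imageProj_eq_iff φ).1 ((hfib a ha).trans (hfib b hb).symm) _ hmem
  · have := congrArg (imageRestrict φ K.2) hx
    change imageProj φ (K.1 : Set C(X, ℝ)) x' ∈ V'
    exact (show imageProj φ (K.1 : Set C(X, ℝ)) x' = imageProj φ (K.1 : Set C(X, ℝ)) x from
      this) ▸ hxV'

/-! ### The two implications -/

variable {F : CompHaus.{u} ⥤ CompHaus.{u}}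

theorem IsMecw.skeletallyGenerated_obj (hF : IsMecw F) (hpre : PreservesPreimages F)
    {X : CompHaus.{u}} (hX : SkeletallyGenerated X) : SkeletallyGenerated (F.obj X) := by
  obtain ⟨g₁, hg₁, hA₁⟩ := exists_operation_of_skeletallyGenerated hX
  obtain ⟨g₂, hg₂, hA₂⟩ := exists_operation_isolated X
  refine skeletallyGenerated_of_isClosedUnder hF.continuous hF.epimorphic hF.secondCountable
    (fun h : C(X, ℝ) => h) ?_ (g := fun K => g₁ K ∪ g₂ K) (fun K => (hg₁ K).union (hg₂ K)) ?_
  · intro x y h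
    by_contra hne
    obtain ⟨f, hf⟩ := exists_continuousMap_ne hne
    exact hf (h f)
  · intro A hAc hA
    exact hF.map_isSkeletal hpre _ (imageProj_surjective _ A)
      (hA₁ A hAc fun K hK => Set.subset_union_left.trans (hA K hK))
      (hA₂ A fun K hK => Set.subset_union_right.trans (hA K hK))

theorem IsMecw.skeletallyGenerated_of_obj (hF : IsMecw F) (hpre : PreservesPreimages F)
    (hne : OneNeTwo F) {X : CompHaus.{u}} (hX : SkeletallyGenerated (F.obj X)) :
    SkeletallyGenerated X := by
  obtain ⟨g', hg', hA'⟩ := exists_operation_of_skeletallyGenerated hX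
  let ψ : C(X, ℝ) → C(X, ℝ) := fun h => h
  have hψ : ∀ x y, (∀ h, ψ h x = ψ h y) → x = y := by
    intro x y h
    by_contra hne
    obtain ⟨f, hf⟩ := exists_continuousMap_ne hne
    exact hf (h f)
  have hmap : ∀ {A B : Set C(X, ℝ)}, A ⊆ B → ∀ u v : F.obj X,
      F.map (imageProj ψ B) u = F.map (imageProj ψ B) v →
      F.map (imageProj ψ A) u = F.map (imageProj ψ A) v := by
    intro A B h u v huv
    rw [← imageProj_comp_imageRestrict ψ h, ← map_map, ← map_map, huv]
  have hD := fun K : Finset C(X, ℝ) => exists_countable_fibers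
    (hF.secondCountable _ (secondCountable_imageSpace ψ K.countable_toSet))
    (F.map (imageProj ψ (K : Set C(X, ℝ)))) (by fun_prop)
  choose D hDc hDf using hD
  have hB : ∀ h : C(F.obj X, ℝ), ∃ B : Set C(X, ℝ), B.Countable ∧ ∀ u v : F.obj X,
      F.map (imageProj ψ B) u = F.map (imageProj ψ B) v → h u = h v := by
    classical
    intro h
    let A : Finset C(X, ℝ) →o Set C(X, ℝ) := ⟨fun K => K, fun K L h => Finset.coe_subset.2 h⟩
    obtain ⟨s, hs, hsh⟩ := exists_countable_factor
      (fun (K : Finset C(X, ℝ)) u => F.map (imageProj ψ (A K)) u) (fun K => by fun_prop)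
      (fun K L h u v => hmap (A.monotone h) u v)
      (fun u v h => hF.continuous.map_injective ψ A
        (fun x y h => hψ x y fun f => h {f} f (Finset.mem_singleton_self f)) h) h
    refine ⟨⋃ K ∈ s, (K : Set C(X, ℝ)), hs.biUnion fun K _ => K.countable_toSet, ?_⟩
    intro u v huv
    exact hsh u v fun K hK =>
      hmap (Set.subset_biUnion_of_mem (u := fun K : Finset C(X, ℝ) => (K : Set C(X, ℝ))) hK) u v huv
  choose B hBc hBf using hB
  -- Functions on `X` and on `F X` are closed up simultaneously. Those on `F X` act on `X` as zero,
  -- leaving the quotient unchanged; `B` and `D` synchronise the two sides, and `g'` makes the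
  -- quotient of `F X` skeletal.
  refine skeletallyGenerated_of_isClosedUnder (G := 𝟭 CompHaus.{u}) (fun Λ _ _ _ => inferInstance)
    (fun _ _ _ h => h) (fun _ h => h) (H := C(X, ℝ) ⊕ C(F.obj X, ℝ))
    (Sum.elim (fun h => h) fun _ => 0) (fun x y h => hψ x y fun f => h (Sum.inl f))
    (g := fun K => Sum.inl '' (⋃ h ∈ K.toRight, B h) ∪ Sum.inr '' (D K.toLeft ∪ g' K.toRight))
    ?_ ?_
  · intro K
    exact (((Finset.countable_toSet K.toRight).biUnion fun h _ => hBc h).image _).union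
      (((hDc _).union (hg' _)).image _)
  · intro A hAc hA
    let A₁ : Set C(X, ℝ) := Sum.inl ⁻¹' A
    let A₂ : Set C(F.obj X, ℝ) := Sum.inr ⁻¹' A
    have hA₂c : A₂.Countable := hAc.preimage Sum.inr_injective
    have hg'A : IsClosedUnder g' A₂ := by
      intro K hK h hh
      refine hA (K.map Function.Embedding.inr) ?_ (Or.inr ⟨h, Or.inr ?_, rfl⟩)
      · rintro _ hz
        obtain ⟨k, hk, rfl⟩ := Finset.mem_map.1 hz
        exact hK hk
      · rwa [show (K.map Function.Embedding.inr).toRight = K by ext; simp]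
    have hDA : ∀ K : Finset C(X, ℝ), (K : Set C(X, ℝ)) ⊆ A₁ → D K ⊆ A₂ := by
      intro K hK h hh
      refine hA (K.map Function.Embedding.inl) ?_ (Or.inr ⟨h, Or.inl ?_, rfl⟩)
      · rintro _ hz
        obtain ⟨k, hk, rfl⟩ := Finset.mem_map.1 hz
        exact hK hk
      · rwa [show (K.map Function.Embedding.inl).toLeft = K by ext; simp]
    have hBA : ∀ h ∈ A₂, B h ⊆ A₁ := by
      intro h hh f hf
      refine hA {Sum.inr h} (by rw [Finset.coe_singleton]; exact Set.singleton_subset_iff.2 hh) (Or.inl ⟨f, ?_, rfl⟩)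
      simpa using hf
    have h1 : IsSkeletal (F.map (imageProj ψ A₁)) := by
      refine IsSkeletal.congr_fibers (p := imageProj (fun h => h) A₂) (by fun_prop)
        (imageProj_surjective _ _) (by fun_prop) (hF.epimorphic _ _ _ (imageProj_surjective _ _))
        ?_ (hA' A₂ hA₂c hg'A)
      intro u v
      rw [imageProj_eq_iff]
      constructor
      · intro h
        refine hF.continuous.map_imageProj_eq ψ (finsetsInHom A₁) A₁ (fun K => K.2)
          (subset_iUnion_finsetsInHom A₁) fun K => ?_
        exact (hDf K.1 u v).1 fun f hf => h f (hDA K.1 K.2 hf)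
      · intro huv h hh
        exact hBf h u v (hmap (hBA h hh) u v huv)
    refine IsSkeletal.congr_fibers (p := imageProj ψ A₁) (by fun_prop) (imageProj_surjective _ _)
      (by fun_prop) (imageProj_surjective _ A) ?_ (hF.isSkeletal_of_map hpre hne _ h1)
    intro x y
    rw [imageProj_eq_iff, Functor.id_map, imageProj_eq_iff]
    constructor
    · rintro h (f | f) hf
      · exact h f hf
      · rfl
    · intro h f hf
      exact h (Sum.inl f) hf

end SkeletalFunctors

theorem theorem1p7 (F : CompHaus.{u} ⥤ CompHaus.{u}) (hF : SkeletalFunctors.IsMecw F)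
    (hpre : SkeletalFunctors.PreservesPreimages F) (hne : SkeletalFunctors.OneNeTwo F)
    (X : CompHaus.{u}) :
    SkeletalFunctors.SkeletallyGenerated X ↔ SkeletalFunctors.SkeletallyGenerated (F.obj X) :=
  ⟨hF.skeletallyGenerated_obj hpre, hF.skeletallyGenerated_of_obj hpre hne⟩
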